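/- Let $d\in\{1,2\}$, let $L_1,\dots,L_d>0$, and put $\Lambda=L_1\mathbb{Z}\times L_2\mathbb{Z}$ if $d=2$ and $\Lambda=L_1\mathbb{Z}\times\{0\}$ if $d=1$. Let $\Omega\subseteq\mathbb{R}^2$ be a nonempty connected open set of class $C^3$ with $\Omega+k=\Omega$ for all $k\in\Lambda$ and, if $d=1$, bounded in the second variable: there is $R\ge 0$ such that $|z_2|\le R$ for all $z=(z_1,z_2)\in\Omega$. Let $C=\{z\in\Omega : z_i\in(0,L_i)\text{ for } 1\le i\le d\}$ be its periodicity cell, and let $\nu$ be the unit outward normal on $\partial\Omega$. Let $q$ be a vector field of class $C^{1,\delta}(\overline{\Omega})$ for some $\delta>0$, with values in $\mathbb{R}^2$, such that $q(z+k)=q(z)$ for all $z\in\overline\Omega$ and $k\in\Lambda$, $\nabla\cdot q=0$ in $\overline\Omega$, $q\cdot\nu=0$ on $\partial\Omega$, and $\int_C q_i=0$ for $1\le i\le d$. For $x\in\Omega$ let $T(x)\subseteq\Omega$ be the trajectory of $q$ in $\Omega$ through $x$, that is, the image of the maximal solution in $\Omega$ of $\gamma'=q(\gamma)$, $\gamma(0)=x$.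 For $\mathbf{a}\in\Lambda\setminus\{0\}$ we say that $T(x)$ is $\mathbf{a}$-periodic if $T(x)=T(x)+\mathbf{a}$; $T(x)$ is called an unbounded periodic trajectory if it is $\mathbf{a}$-periodic for some $\mathbf{a}\in\Lambda\setminus\{0\}$. If $T(x)$ is an unbounded periodic trajectory of $q$ in $\Omega$ that is $\mathbf{a}$-periodic, then every unbounded periodic trajectory $T(y)$ of $q$ in $\Omega$ is also $\mathbf{a}$-periodic. Moreover, if $d=1$, then every unbounded periodic trajectory of $q$ in $\Omega$ is $L_1e_1$-periodic, where $e_1=(1,0)$. -/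

import Mathlib

open Set Filter Topology MeasureTheory
open scoped NNReal Pointwise Gradient

namespace PeriodicFlow

/-- The space `ℝ^N` with its Euclidean norm. -/
abbrev Space (N : ℕ) : Type := EuclideanSpace ℝ (Fin N)

/-- The lattice `L₁ℤ × ⋯ × L_dℤ × {0}^{N-d}`; only the first `d` entries of `L` matter. -/
def lattice {N : ℕ} (d : ℕ) (L : Fin N → ℝ) : Set (Space N) :=
  {k | ∀ i : Fin N, (i.val < d → ∃ m : ℤ, k i = m * L i) ∧ (d ≤ i.val → k i = 0)}

/-- `ρ` is a `C³` local defining function of `Ω` at `p`: near `p`, the set `Ω` is `{ρ < 0}`, and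
`∇ρ(p) ≠ 0`. -/
structure IsLocalDefiningFunction {N : ℕ} (Ω : Set (Space N)) (p : Space N)
    (ρ : Space N → ℝ) : Prop where
  contDiffAt : ContDiffAt ℝ 3 ρ p
  gradient_ne_zero : ∇ ρ p ≠ 0
  eventually_mem_iff : ∀ᶠ z in 𝓝 p, z ∈ Ω ↔ ρ z < 0

/-- A nonempty connected open set with boundary of class `C³`. -/
structure IsC3Domain {N : ℕ} (Ω : Set (Space N)) : Prop where
  isOpen : IsOpen Ω
  isConnected : IsConnected Ω
  boundary : ∀ p ∈ frontier Ω, ∃ ρ : Space N → ℝ, IsLocalDefiningFunction Ω p ρ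

/-- `ν` is the unit outward normal to `∂Ω` at the boundary point `p`. -/
def IsOutwardUnitNormal {N : ℕ} (Ω : Set (Space N)) (p ν : Space N) : Prop :=
  p ∈ frontier Ω ∧ ∃ ρ : Space N → ℝ, IsLocalDefiningFunction Ω p ρ ∧ ν = ‖∇ ρ p‖⁻¹ • ∇ ρ p

/-- The standing assumptions on the domain: a `C³` domain of `ℝ^N`, periodic with periods
`L₁, …, L_d` in the first `d` variables `x` and bounded in the other `N - d` variables `y`. -/
structure IsPeriodicDomain {N : ℕ} (d : ℕ) (L : Fin N → ℝ) (Ω : Set (Space N)) : Prop where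
  one_le : 1 ≤ d
  le_dim : d ≤ N
  period_pos : ∀ i : Fin N, i.val < d → 0 < L i
  isC3Domain : IsC3Domain Ω
  bounded_y : ∃ R : ℝ, 0 ≤ R ∧
    ∀ z ∈ Ω, √(∑ i : Fin N with d ≤ i.val, z i ^ 2) ≤ R
  periodic : ∀ k ∈ lattice d L, k +ᵥ Ω = Ω

/-- The periodicity cell `C = {(x, y) ∈ Ω ; x₁ ∈ (0, L₁), …, x_d ∈ (0, L_d)}`. -/
def cell {N : ℕ} (d : ℕ) (L : Fin N → ℝ) (Ω : Set (Space N)) : Set (Space N) :=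
  {z | z ∈ Ω ∧ ∀ i : Fin N, i.val < d → z i ∈ Ioo 0 (L i)}

/-- The class `C^{1,δ}(closure Ω)`: `q` is continuous on `closure Ω` and differentiable in `Ω`, and
its derivative extends to a `δ`-Hölder continuous map on `closure Ω`. -/
def IsC1Holder {N : ℕ} (δ : ℝ≥0) (Ω : Set (Space N)) (q : Space N → Space N) : Prop :=
  ContinuousOn q (closure Ω) ∧ ∃ G : Space N → (Space N →L[ℝ] Space N),
    (∀ z ∈ Ω, HasFDerivAt q (G z) z) ∧ ∃ K : ℝ≥0, HolderOnWith K δ G (closure Ω)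

/-- The divergence `∑ᵢ ∂ᵢqᵢ` of `q` at `z`. -/
noncomputable def divergence {N : ℕ} (q : Space N → Space N) (z : Space N) : ℝ :=
  ∑ i : Fin N, (fderiv ℝ q z (EuclideanSpace.single i 1)) i

/-- The standing assumptions on the advection field: `q` is of class `C^{1,δ}(closure Ω)` for some
`δ > 0`, `L`-periodic with respect to `x`, divergence free (in `Ω`, hence on `closure Ω` for the
continuous extension of the derivative), tangent to `∂Ω`, and its first `d` components have zero
mean over the cell. Only the values of `q` on `closure Ω` matter. -/
structure IsAdvection {N : ℕ} (d : ℕ) (L : Fin N → ℝ) (Ω : Set (Space N))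
    (q : Space N → Space N) : Prop where
  regular : ∃ δ : ℝ≥0, 0 < δ ∧ IsC1Holder δ Ω q
  periodic : ∀ k ∈ lattice d L, ∀ z ∈ closure Ω, q (z + k) = q z
  div_free : ∀ z ∈ Ω, divergence q z = 0
  tangent : ∀ p ν : Space N, IsOutwardUnitNormal Ω p ν → inner ℝ (q p) ν = 0
  zero_mean : ∀ i : Fin N, i.val < d → ∫ z in cell d L Ω, q z i = 0

/-- The trajectory `T(x)` of `q` in `Ω` through `x`: the set of all points reached by solutions
`γ' = q(γ)`, `γ(0) = x`, with values in `Ω`, on open intervals around `0`. -/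
def trajectory {N : ℕ} (Ω : Set (Space N)) (q : Space N → Space N) (x : Space N) :
    Set (Space N) :=
  {z | ∃ (I : Set ℝ) (γ : ℝ → Space N), IsOpen I ∧ I.OrdConnected ∧ 0 ∈ I ∧ γ 0 = x ∧
    (∀ t ∈ I, γ t ∈ Ω ∧ HasDerivAt γ (q (γ t)) t) ∧ ∃ t ∈ I, γ t = z}

/-- The set `T` is `a`-periodic: `a` is a nonzero vector of the lattice and `T = T + a`. -/
def IsPeriodicWith {N : ℕ} (d : ℕ) (L : Fin N → ℝ) (a : Space N) (T : Set (Space N)) : Prop :=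
  a ∈ lattice d L ∧ a ≠ 0 ∧ a +ᵥ T = T

/-- `T(x)` is an unbounded periodic trajectory of `q` in `Ω`: it is `a`-periodic for some `a`. -/
def IsUnboundedPeriodic {N : ℕ} (d : ℕ) (L : Fin N → ℝ) (Ω : Set (Space N))
    (q : Space N → Space N) (x : Space N) : Prop :=
  x ∈ Ω ∧ ∃ a : Space N, IsPeriodicWith d L a (trajectory Ω q x)

end PeriodicFlow

/-!
The theorem is a fact of plane topology about curves that do not cross. Since `q` is of class `C¹`
in `Ω`, trajectories are disjoint or equal (`trajectory_eq_of_mem`), and a lattice translate of a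
trajectory is a trajectory (`vadd_trajectory`). An `a`-periodic trajectory carries a continuous
curve `g` with `g (t + 1) = g t + a` (`exists_translation_equivariant_curve`).

Let `T(x)` be `a`-periodic and `T(y)` be `b`-periodic. If `a` and `b` are linearly independent, the
two curves have to meet (`exists_eq_of_independent_translations`), so `T(x) = T(y)` and there is
nothing left to prove. If `a` and `b` are parallel, `n • a = m • b` for some integers with `n ≠ 0`,
so that `T(y)` is invariant under `n • a`. A plane curve invariant under a nonzero multiple of `a`
has a chord equal to `a` (`exists_eq_add_one_of_translation`); hence `T(y)` meets `a +ᵥ T(y)`, and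
the two are equal. For `d = 1` every period is a multiple of `L₁e₁`, and the same chord argument
applies.

Both plane facts say that a certain map from the plane of parameters to `ℂ` has a zero. Otherwise it
would have a continuous argument (`exists_continuous_arg`), whose variation along a suitable closed
path would be `2π` rather than `0`.
-/

namespace PeriodicFlow

/-! ### Translation-invariant curves in the plane -/

/-- A nowhere vanishing continuous function on the plane has a continuous argument, since the plane is
simply connected and `exp` is a covering map onto `ℂ \ {0}`. -/
theorem exists_continuous_arg {F : ℝ × ℝ → ℂ} (hF : Continuous F) (h0 : ∀ z, F z ≠ 0) :
    ∃ θ : ℝ × ℝ → ℝ, Continuous θ ∧ ∀ z, F z = ‖F z‖ * Complex.exp (θ z * Complex.I) := by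
  obtain ⟨G, ⟨-, hG⟩, -⟩ := Complex.isCoveringMapOn_exp.existsUnique_continuousMap_lifts
    ⟨F, hF⟩ (a₀ := 0) (Complex.exp_log (h0 0)) (fun z => h0 z)
  refine ⟨fun z => (G z).im, by fun_prop, fun z => ?_⟩
  have hz : Complex.exp (G z) = F z := congrFun hG z
  rw [← hz, Complex.norm_exp, Complex.ofReal_exp, ← Complex.exp_add, Complex.re_add_im]

theorem exists_mem_uIcc_eq {u : ℝ → ℝ} (hu : Continuous u) {a b c : ℝ} (h₁ : u a ≤ c)
    (h₂ : c ≤ u b) : ∃ t ∈ uIcc a b, u t = c :=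
  intermediate_value_uIcc hu.continuousOn (Icc_subset_uIcc ⟨h₁, h₂⟩)

/-- A bounded continuous perturbation of the identity of the plane has a zero. Otherwise `F` has a
continuous argument, which returns to its initial value along a large circle, while the argument of
the position vector increases by `2π`; yet the angle between the two vectors stays acute. -/
theorem exists_eq_zero_of_norm_sub_le {F : ℝ × ℝ → ℂ} (hF : Continuous F) {M : ℝ}
    (hM : ∀ s t : ℝ, ‖F (s, t) - (s + t * Complex.I)‖ ≤ M) : ∃ z, F z = 0 := by
  by_contra! h0
  obtain ⟨θ, hθ, hFθ⟩ := exists_continuous_arg hF h0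
  have hM0 : 0 ≤ M := (norm_nonneg _).trans (hM 0 0)
  set R := M + 1 with hR
  set u : ℝ → ℝ := fun φ => θ (R * Real.cos φ, R * Real.sin φ) - φ with hu
  have huc : Continuous u := by fun_prop
  have hcos : ∀ φ, 0 < Real.cos (u φ) := by
    intro φ
    set z : ℝ × ℝ := (R * Real.cos φ, R * Real.sin φ) with hz
    set e : ℂ := Complex.exp (-(φ * Complex.I)) with he
    have hnorm : ‖e‖ = 1 := by
      rw [he, ← neg_mul, ← Complex.ofReal_neg, Complex.norm_exp_ofReal_mul_I]
    have h1 : F z * e = ‖F z‖ * Complex.exp ((u φ : ℝ) * Complex.I) := by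
      rw [hFθ z, he, mul_assoc, ← Complex.exp_add]
      simp only [norm_mul, Complex.norm_exp_ofReal_mul_I, Complex.norm_real, norm_norm, mul_one]
      congr 2
      simp only [hu]; push_cast; ring
    have h2 : (((z.1 : ℂ) + z.2 * Complex.I) * e) = R := by
      have : ((z.1 : ℂ) + z.2 * Complex.I) = R * Complex.exp (φ * Complex.I) := by
        rw [Complex.exp_mul_I, hz]; push_cast; ring
      rw [this, he, mul_assoc, ← Complex.exp_add]; simp
    have h3 : F z * e = R + (F z - (z.1 + z.2 * Complex.I)) * e := by
      rw [← h2]; ring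
    have h4 : |((F z - (z.1 + z.2 * Complex.I)) * e).re| ≤ M := by
      refine (Complex.abs_re_le_norm _).trans ?_
      rw [norm_mul, hnorm, mul_one]
      exact hM _ _
    have h5 : 0 < (F z * e).re := by
      rw [h3, Complex.add_re, Complex.ofReal_re]
      linarith [neg_le_of_abs_le h4]
    rw [h1, Complex.re_ofReal_mul, Complex.exp_ofReal_mul_I_re] at h5
    exact pos_of_mul_pos_right h5 (norm_nonneg _)
  have hper : u (2 * Real.pi) = u 0 - 2 * Real.pi := by simp [hu]
  set k : ℤ := ⌊u 0 / Real.pi - 1 / 2⌋ with hk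
  have hk1 : (k : ℝ) ≤ u 0 / Real.pi - 1 / 2 := Int.floor_le _
  have hk2 : u 0 / Real.pi - 1 / 2 < k + 1 := Int.lt_floor_add_one _
  have e1 : u 0 / Real.pi * Real.pi = u 0 := div_mul_cancel₀ _ Real.pi_ne_zero
  have g1 := mul_le_mul_of_nonneg_right hk1 Real.pi_pos.le
  have g2 := mul_lt_mul_of_pos_right hk2 Real.pi_pos
  rw [sub_mul, e1] at g1 g2
  obtain ⟨t, -, ht⟩ := exists_mem_uIcc_eq huc (a := 2 * Real.pi) (b := 0)
    (c := (2 * k + 1) * Real.pi / 2) (by linarith [Real.pi_pos]) (by linarith)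
  exact (hcos t).ne' (Real.cos_eq_zero_iff.2 ⟨k, ht⟩)

/-- A curve `g` with `g (t + 1) = g t + c` stays within bounded distance of the line `t ↦ t • c`. -/
theorem exists_norm_sub_smul_le {E : Type*} [NormedAddCommGroup E] [NormedSpace ℝ E]
    {g : ℝ → E} {c : E} (hg : Continuous g) (hc : ∀ t, g (t + 1) = g t + c) :
    ∃ M, ∀ t, ‖g t - t • c‖ ≤ M := by
  have hper : Function.Periodic (fun t => g t - t • c) 1 := fun t => by
    simp only [hc, add_smul, one_smul]; abel
  obtain ⟨M, hM⟩ := (hper.compact_of_continuous one_ne_zero (by fun_prop)).isBounded.exists_norm_le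
  exact ⟨M, fun t => hM _ (mem_range_self t)⟩

/-- Two curves in the plane, invariant under translations by two linearly independent vectors
(normalised to `1` and `w`), meet. -/
theorem exists_eq_of_independent_translations {g₁ g₂ : ℝ → ℂ} {w : ℂ} (hw : w.im ≠ 0)
    (hg₁ : Continuous g₁) (hg₂ : Continuous g₂) (h₁ : ∀ t, g₁ (t + 1) = g₁ t + 1)
    (h₂ : ∀ t, g₂ (t + 1) = g₂ t + w) : ∃ s t, g₁ s = g₂ t := by
  obtain ⟨M₁, hM₁⟩ := exists_norm_sub_smul_le hg₁ h₁
  obtain ⟨M₂, hM₂⟩ := exists_norm_sub_smul_le hg₂ h₂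
  -- The parameters are chosen so that `g₁ (·) - g₂ (·)` is a bounded perturbation of `s + t * I`.
  obtain ⟨⟨s, t⟩, hst⟩ := exists_eq_zero_of_norm_sub_le
    (F := fun z => g₁ (z.1 - z.2 / w.im * w.re) - g₂ (-(z.2 / w.im)))
    (by fun_prop) (M := M₁ + M₂) (fun s t => by
      have e : g₁ (s - t / w.im * w.re) - g₂ (-(t / w.im)) - (s + t * Complex.I)
          = (g₁ (s - t / w.im * w.re) - (s - t / w.im * w.re) • (1 : ℂ))
            - (g₂ (-(t / w.im)) - (-(t / w.im)) • w) := by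
        have : (t : ℂ) * Complex.I = -(t / w.im * w.re) + t / w.im * w := by
          apply Complex.ext <;> simp [← Complex.ofReal_div, hw]
        rw [this]
        simp only [Complex.real_smul]
        push_cast
        ring
      change ‖g₁ (s - t / w.im * w.re) - g₂ (-(t / w.im)) - (s + t * Complex.I)‖ ≤ _
      rw [e]
      exact (norm_sub_le _ _).trans (add_le_add (hM₁ _) (hM₂ _)))
  exact ⟨_, _, sub_eq_zero.1 hst⟩

/-- A universal chord theorem in the plane: a curve invariant under translation by `c > 0` has a
chord equal to `1`. Put the origin of parameters at a highest point of the curve. If no chord is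
`1`, the vector `F (s, t) = g s - g t - 1` has a continuous argument on the triangle with vertices
`(0, 0)`, `(0, -N)`, `(N, 0)`. It equals `-1` at `(0, 0)`, and for large `N` it points to the right
on the opposite side. Along `s = 0` it stays in the closed upper half-plane and turns
clockwise, along `t = 0` it stays in the closed lower half-plane and turns the other way, so the
argument would change by more than `π` along the opposite side, where it varies by less than `π`. -/
theorem exists_eq_add_one_of_translation {g : ℝ → ℂ} {c : ℝ} (hc : 0 < c) (hg : Continuous g)
    (h : ∀ t, g (t + 1) = g t + c) : ∃ s t, g s = g t + 1 := by
  by_contra! hne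
  obtain ⟨M, hM⟩ := exists_norm_sub_smul_le hg h
  obtain ⟨_, ⟨s₀, rfl⟩, hs₀⟩ : ∃ m, IsGreatest (range fun t => (g t).im) m := by
    have hper : Function.Periodic (fun t => (g t).im) 1 := fun t => by simp [h]
    exact (hper.compact_of_continuous one_ne_zero (by fun_prop)).exists_isGreatest
      (range_nonempty _)
  replace hs₀ : ∀ t, (g t).im ≤ (g s₀).im := fun t => hs₀ (mem_range_self t)
  obtain ⟨θ, hθ, hFθ⟩ := exists_continuous_arg
    (F := fun z => g (z.1 + s₀) - g (z.2 + s₀) - 1) (by fun_prop)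
    (fun z hz => hne (z.1 + s₀) (z.2 + s₀) (by linear_combination hz))
  have hre : ∀ z : ℝ × ℝ, (g (z.1 + s₀) - g (z.2 + s₀) - 1).re =
      ‖g (z.1 + s₀) - g (z.2 + s₀) - 1‖ * Real.cos (θ z) := fun z => by
    rw [← Complex.exp_ofReal_mul_I_re, ← Complex.re_ofReal_mul, ← hFθ z]
  have him : ∀ z : ℝ × ℝ, (g (z.1 + s₀) - g (z.2 + s₀) - 1).im =
      ‖g (z.1 + s₀) - g (z.2 + s₀) - 1‖ * Real.sin (θ z) := fun z => by
    rw [← Complex.exp_ofReal_mul_I_im, ← Complex.im_ofReal_mul, ← hFθ z]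
  have hpos : ∀ z : ℝ × ℝ, 0 < ‖g (z.1 + s₀) - g (z.2 + s₀) - 1‖ := fun z =>
    norm_pos_iff.2 fun hz => hne (z.1 + s₀) (z.2 + s₀) (by linear_combination hz)
  -- At the origin the vector is `-1`, so its argument is `π` modulo `2π`.
  have h00 : Real.cos (θ (0, 0)) = -1 := by simpa using (hre (0, 0)).symm
  obtain ⟨k, hk⟩ := Real.cos_eq_neg_one_iff.1 h00
  set α : ℝ × ℝ → ℝ := fun z => θ z - k * (2 * Real.pi) with hα
  have hαc : Continuous α := by fun_prop
  have hcos : ∀ z, Real.cos (α z) = Real.cos (θ z) := fun z => Real.cos_sub_int_mul_two_pi _ _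
  have hsin : ∀ z, Real.sin (α z) = Real.sin (θ z) := fun z => Real.sin_sub_int_mul_two_pi _ _
  have hα0 : α (0, 0) = Real.pi := by simp only [hα]; linarith
  have hup : ∀ t, 0 ≤ Real.sin (α (0, t)) := fun t => by
    rw [hsin]
    refine nonneg_of_mul_nonneg_right ?_ (hpos (0, t))
    rw [← him]
    simpa using hs₀ (t + s₀)
  have hdown : ∀ s, Real.sin (α (s, 0)) ≤ 0 := fun s => by
    rw [hsin]
    refine nonpos_of_mul_nonpos_right ?_ (hpos (s, 0))
    rw [← him]
    simpa using hs₀ (s + s₀)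
  -- Far from the diagonal, the vector points to the right.
  set N : ℝ := (2 * M + 2) / c with hN
  have hright : ∀ r, 0 < Real.cos (α (r, r - N)) := fun r => by
    rw [hcos]
    refine pos_of_mul_pos_right ?_ (hpos (r, r - N)).le
    rw [← hre]
    have e1 := abs_le.1 ((Complex.abs_re_le_norm _).trans (hM (r + s₀)))
    have e2 := abs_le.1 ((Complex.abs_re_le_norm _).trans (hM (r - N + s₀)))
    have e3 : N * c = 2 * M + 2 := div_mul_cancel₀ _ hc.ne'
    simp only [Complex.sub_re, Complex.real_smul, Complex.re_ofReal_mul, Complex.ofReal_re,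
      Complex.one_re] at e1 e2 ⊢
    nlinarith
  have hpi := Real.pi_pos
  have hsin1 : Real.sin (-(Real.pi / 2)) = -1 := by simp
  have hsin2 : Real.sin (3 * (Real.pi / 2)) = -1 := by
    rw [show 3 * (Real.pi / 2) = -(Real.pi / 2) + 2 * Real.pi by ring, Real.sin_add_two_pi, hsin1]
  -- The argument starts from `π` and cannot cross an angle whose sine has the wrong sign.
  have hA : α (0, -N) < Real.pi / 2 := by
    by_contra! hA
    have hc0 := hright 0
    rw [zero_sub] at hc0
    obtain hA' | hA' := le_or_gt (3 * (Real.pi / 2)) (α (0, -N))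
    · obtain ⟨t, -, ht⟩ := exists_mem_uIcc_eq (u := fun t => α (0, t)) (by fun_prop)
        (a := 0) (by rw [hα0]; linarith) hA'
      have := hup t
      rw [ht, hsin2] at this
      linarith
    · exact hc0.not_ge (Real.cos_nonpos_of_pi_div_two_le_of_le hA (by linarith))
  have hB : 3 * (Real.pi / 2) < α (N, 0) := by
    by_contra! hB
    have hc0 := hright N
    rw [sub_self] at hc0
    obtain hB' | hB' := le_or_gt (α (N, 0)) (Real.pi / 2)
    · obtain ⟨t, -, ht⟩ := exists_mem_uIcc_eq (u := fun t => α (t, 0)) (by fun_prop)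
        (b := 0) hB' (by rw [hα0]; linarith)
      have := hdown t
      rw [ht, Real.sin_pi_div_two] at this
      linarith
    · exact hc0.not_ge (Real.cos_nonpos_of_pi_div_two_le_of_le hB'.le (by linarith))
  obtain ⟨r, -, hr⟩ := exists_mem_uIcc_eq (u := fun r => α (r, r - N)) (by fun_prop)
    (a := 0) (b := N) (c := Real.pi) (by rw [zero_sub]; linarith) (by rw [sub_self]; linarith)
  have := hright r
  rw [hr, Real.cos_pi] at this
  linarith

/-! ### Trajectories of a `C¹` vector field -/

/-- Two integral curves in `Ω` of a vector field which is `C¹` at the points of `Ω` agree on every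
open interval on which both are defined, as soon as they agree at one point of it. -/
theorem eqOn_of_hasDerivAt {E : Type*} [NormedAddCommGroup E] [NormedSpace ℝ E]
    {v : E → E} {Ω : Set E} (hv : ∀ z ∈ Ω, ContDiffAt ℝ 1 v z) {J : Set ℝ} (hJo : IsOpen J)
    (hJ : IsPreconnected J) {f g : ℝ → E}
    (hf : ∀ t ∈ J, f t ∈ Ω ∧ HasDerivAt f (v (f t)) t)
    (hg : ∀ t ∈ J, g t ∈ Ω ∧ HasDerivAt g (v (g t)) t) {t₀ : ℝ} (ht₀ : t₀ ∈ J)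
    (h₀ : f t₀ = g t₀) : EqOn f g J := by
  have local_unique : ∀ t ∈ J, f t = g t → f =ᶠ[𝓝 t] g := by
    intro t ht hfg
    obtain ⟨K, s, hs, hK⟩ := (hv _ (hf t ht).1).exists_lipschitzOnWith
    have hJt := hJo.mem_nhds ht
    refine ODE_solution_unique_of_eventually (v := fun _ => v) (s := fun _ => s) (K := K)
      (Eventually.of_forall fun _ => hK) ?_ ?_ hfg
    · filter_upwards [hJt, (hf t ht).2.continuousAt.preimage_mem_nhds hs] with r hr hrs
      exact ⟨(hf r hr).2, hrs⟩
    · filter_upwards [hJt, (hg t ht).2.continuousAt.preimage_mem_nhds (hfg ▸ hs)] with r hr hrs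
      exact ⟨(hg r hr).2, hrs⟩
  have hsub : J ⊆ {t | f =ᶠ[𝓝 t] g} := by
    refine hJ.subset_of_closure_inter_subset isOpen_setOfPred_eventually_nhds
      ⟨t₀, ht₀, local_unique t₀ ht₀ h₀⟩ ?_
    rintro t ⟨htc, ht⟩
    refine local_unique t ht ?_
    have hfr : ∃ᶠ r in 𝓝 t, f r = g r :=
      (mem_closure_iff_frequently.1 htc).mono fun r hr => hr.self_of_nhds
    by_contra hne
    exact hfr (((hf t ht).2.continuousAt.prodMk (hg t ht).2.continuousAt).eventually
      (isClosed_diagonal.isOpen_compl.mem_nhds hne))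
  exact fun t ht => (hsub ht).self_of_nhds

section Trajectories

variable {N d : ℕ} {L : Fin N → ℝ} {Ω : Set (Space N)} {q : Space N → Space N}

theorem IsAdvection.contDiffAt (hΩ : IsOpen Ω) (hq : IsAdvection d L Ω q) {z : Space N}
    (hz : z ∈ Ω) : ContDiffAt ℝ 1 q z := by
  obtain ⟨δ, hδ, -, G, hG, K, hK⟩ := hq.regular
  exact contDiffAt_one_iff.2
    ⟨G, Ω, hΩ.mem_nhds hz, (hK.continuousOn hδ).mono subset_closure, hG⟩

theorem mem_trajectory_self (hΩ : IsOpen Ω) (hv : ∀ z ∈ Ω, ContDiffAt ℝ 1 q z) {x : Space N}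
    (hx : x ∈ Ω) : x ∈ trajectory Ω q x := by
  obtain ⟨γ, hγ0, ε, hε, hγ⟩ :=
    (hv x hx).exists_forall_mem_closedBall_exists_eq_forall_mem_Ioo_hasDerivAt₀ 0
  rw [zero_sub, zero_add] at hγ
  have hc : ContinuousAt γ 0 := (hγ 0 ⟨by linarith, hε⟩).continuousAt
  obtain ⟨r, hr, hball⟩ := Metric.mem_nhds_iff.1
    (hc.preimage_mem_nhds (hΩ.mem_nhds (hγ0 ▸ hx)))
  rw [Real.ball_eq_Ioo, zero_sub, zero_add] at hball
  have hm : 0 < min ε r := lt_min hε hr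
  refine ⟨Ioo (-min ε r) (min ε r), γ, isOpen_Ioo, ordConnected_Ioo, ⟨by linarith, hm⟩, hγ0,
    fun t ht => ⟨hball ⟨?_, ?_⟩, hγ t ⟨?_, ?_⟩⟩, 0, ⟨by linarith, hm⟩, hγ0⟩
  all_goals linarith [ht.1, ht.2, min_le_left ε r, min_le_right ε r]

theorem trajectory_symm {x z : Space N} (h : z ∈ trajectory Ω q x) : x ∈ trajectory Ω q z := by
  obtain ⟨I, γ, hIo, hI, h0, rfl, hγ, t₁, ht₁, rfl⟩ := h
  refine ⟨(· + t₁) ⁻¹' I, fun t => γ (t + t₁), hIo.preimage (by fun_prop), ?_, by simpa using ht₁,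
    by simp, fun t ht => ⟨(hγ _ ht).1, (hγ _ ht).2.comp_add_const t t₁⟩, -t₁, by simpa using h0,
    by simp⟩
  exact hI.preimage_mono fun a b hab => by simpa using hab

/-- Integral curves through a common point are glued into one; by uniqueness they agree on the overlap
of their intervals. -/
theorem trajectory_subset_of_mem (hv : ∀ z ∈ Ω, ContDiffAt ℝ 1 q z) {x z : Space N}
    (h : z ∈ trajectory Ω q x) : trajectory Ω q z ⊆ trajectory Ω q x := by
  classical
  obtain ⟨I, γ, hIo, hI, h0I, hγ0, hγ, t₁, ht₁, hz⟩ := h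
  rintro _ ⟨J, η, hJo, hJ, h0J, hη0, hη, u, hu, rfl⟩
  set J' : Set ℝ := (· - t₁) ⁻¹' J with hJ'
  have hJ'o : IsOpen J' := hJo.preimage (by fun_prop)
  have hJ'c : J'.OrdConnected := hJ.preimage_mono fun a b hab => by simpa using hab
  have ht₁J : t₁ ∈ J' := by simpa [hJ'] using h0J
  have hη' : ∀ t ∈ J', η (t - t₁) ∈ Ω ∧ HasDerivAt (fun t => η (t - t₁)) (q (η (t - t₁))) t :=
    fun t ht => ⟨(hη _ ht).1, (hη _ ht).2.comp_sub_const t t₁⟩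
  have heq : EqOn γ (fun t => η (t - t₁)) (I ∩ J') :=
    eqOn_of_hasDerivAt hv (hIo.inter hJ'o) (hI.inter hJ'c).isPreconnected
      (fun t ht => hγ t ht.1) (fun t ht => hη' t ht.2) ⟨ht₁, ht₁J⟩ (by simp [hz, hη0])
  set ζ : ℝ → Space N := fun t => if t ∈ I then γ t else η (t - t₁) with hζ
  have hζI : EqOn ζ γ I := fun t ht => if_pos ht
  have hζJ : EqOn ζ (fun t => η (t - t₁)) J' := fun t ht => by
    by_cases htI : t ∈ I
    · exact (hζI htI).trans (heq ⟨htI, ht⟩)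
    · exact if_neg htI
  refine ⟨I ∪ J', ζ, hIo.union hJ'o,
    (hI.isPreconnected.union t₁ ht₁ ht₁J hJ'c.isPreconnected).ordConnected, Or.inl h0I,
    (hζI h0I).trans hγ0, ?_, u + t₁, Or.inr (by simpa [hJ'] using hu), ?_⟩
  -- Each point has a neighbourhood on which `ζ` is `γ` or the shifted `η`.
  · rintro t (ht | ht)
    · rw [hζI ht]
      exact ⟨(hγ t ht).1, (hγ t ht).2.congr_of_eventuallyEq
        (hζI.eventuallyEq_of_mem (hIo.mem_nhds ht))⟩
    · rw [hζJ ht]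
      exact ⟨(hη' t ht).1, (hη' t ht).2.congr_of_eventuallyEq
        (hζJ.eventuallyEq_of_mem (hJ'o.mem_nhds ht))⟩
  · have : u + t₁ ∈ J' := by simpa [hJ'] using hu
    rw [hζJ this]
    simp

/-- Two trajectories with a common point are equal. -/
theorem trajectory_eq_of_mem (hv : ∀ z ∈ Ω, ContDiffAt ℝ 1 q z) {x z : Space N}
    (h : z ∈ trajectory Ω q x) : trajectory Ω q z = trajectory Ω q x :=
  (trajectory_subset_of_mem hv h).antisymm (trajectory_subset_of_mem hv (trajectory_symm h))

theorem neg_mem_lattice {k : Space N} (hk : k ∈ lattice d L) : -k ∈ lattice d L := by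
  refine fun i => ⟨fun hi => ?_, fun hi => ?_⟩
  · obtain ⟨m, hm⟩ := (hk i).1 hi
    exact ⟨-m, by simp [hm]⟩
  · simp [(hk i).2 hi]

theorem vadd_trajectory_subset (hΩ : ∀ k ∈ lattice d L, k +ᵥ Ω = Ω) (hq : IsAdvection d L Ω q)
    {k : Space N} (hk : k ∈ lattice d L) (x : Space N) :
    k +ᵥ trajectory Ω q x ⊆ trajectory Ω q (k + x) := by
  rintro _ ⟨_, ⟨I, γ, hIo, hI, h0, rfl, hγ, t₁, ht₁, rfl⟩, rfl⟩
  refine ⟨I, fun t => k + γ t, hIo, hI, h0, rfl, fun t ht => ⟨?_, ?_⟩, t₁, ht₁, rfl⟩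
  · rw [← hΩ k hk]
    exact vadd_mem_vadd_set (hγ t ht).1
  · beta_reduce
    rw [add_comm k, hq.periodic k hk _ (subset_closure (hγ t ht).1)]
    exact (hγ t ht).2.const_add k

theorem vadd_trajectory (hΩ : ∀ k ∈ lattice d L, k +ᵥ Ω = Ω) (hq : IsAdvection d L Ω q)
    {k : Space N} (hk : k ∈ lattice d L) (x : Space N) :
    k +ᵥ trajectory Ω q x = trajectory Ω q (k + x) := by
  refine (vadd_trajectory_subset hΩ hq hk x).antisymm ?_
  rw [subset_vadd_set_iff]
  simpa using vadd_trajectory_subset hΩ hq (neg_mem_lattice hk) (k + x)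

theorem zsmul_vadd_set_eq {a : Space N} {T : Set (Space N)} (h : a +ᵥ T = T) (n : ℤ) :
    n • a +ᵥ T = T :=
  zsmul_mem (K := AddAction.stabilizer (Space N) T) (AddAction.mem_stabilizer_iff.2 h) n

/-- A trajectory invariant under translation by `a` carries a curve `g` with `g (t + 1) = g t + a`: an
arc of the trajectory from `x` to `a + x`, rescaled to `[0, 1]` and continued by translation. It
needs no bound on the existence time of solutions, nor that `g` solve the differential equation. -/
theorem exists_translation_equivariant_curve (hΩ : IsOpen Ω) (hv : ∀ z ∈ Ω, ContDiffAt ℝ 1 q z)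
    {x a : Space N} (hx : x ∈ Ω) (h : a +ᵥ trajectory Ω q x = trajectory Ω q x) :
    ∃ g : ℝ → Space N, Continuous g ∧ (∀ t, g (t + 1) = g t + a) ∧
      ∀ t, g t ∈ trajectory Ω q x := by
  have hxa : a + x ∈ trajectory Ω q x := by
    rw [← h]
    exact vadd_mem_vadd_set (mem_trajectory_self hΩ hv hx)
  obtain ⟨I, γ, hIo, hI, h0, hγ0, hγ, t₁, ht₁, hγ1⟩ := hxa
  have hmem : ∀ r ∈ Icc (0 : ℝ) 1, r * t₁ ∈ I := fun r hr => by
    have := hI.convex.smul_mem_of_zero_mem h0 ht₁ hr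
    simpa using this
  have hcont : ContinuousOn (fun r : ℝ => γ (r * t₁) - r • a) (Icc 0 1) := by
    refine ContinuousOn.sub ?_ (by fun_prop)
    exact ContinuousOn.comp (t := I) (fun t ht => (hγ t ht).2.continuousAt.continuousWithinAt)
      (by fun_prop) hmem
  have hc := hcont.comp_fract'' (by simp [hγ0, hγ1])
  refine ⟨fun t => γ (Int.fract t * t₁) - Int.fract t • a + t • a, ?_, fun t => ?_, fun t => ?_⟩
  · exact Continuous.add hc (by fun_prop)
  · simp only [Int.fract_add_one, add_smul, one_smul]
    abel
  · have hT : γ (Int.fract t * t₁) ∈ trajectory Ω q x :=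
      ⟨I, γ, hIo, hI, h0, hγ0, hγ, _, hmem _ ⟨Int.fract_nonneg t, (Int.fract_lt_one t).le⟩, rfl⟩
    have e : γ (Int.fract t * t₁) - Int.fract t • a + t • a
        = ⌊t⌋ • a +ᵥ γ (Int.fract t * t₁) := by
      have : t • a = (⌊t⌋ : ℝ) • a + Int.fract t • a := by
        rw [← add_smul, Int.floor_add_fract]
      rw [this, vadd_eq_add, Int.cast_smul_eq_zsmul]
      abel
    beta_reduce
    rw [e, ← zsmul_vadd_set_eq h ⌊t⌋]
    exact vadd_mem_vadd_set hT

end Trajectories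

/-! ### Periods of trajectories in the plane -/

/-- The identification `(z₀, z₁) ↦ z₀ + i z₁` of the plane with `ℂ`. -/
noncomputable def toComplex : Space 2 ≃ₗᵢ[ℝ] ℂ := Complex.orthonormalBasisOneI.repr.symm

theorem toComplex_re (z : Space 2) : (toComplex z).re = z 0 := by
  simp [toComplex]

theorem toComplex_im (z : Space 2) : (toComplex z).im = z 1 := by
  simp [toComplex]

section PlaneTrajectories

variable {d : ℕ} {L : Fin 2 → ℝ} {Ω : Set (Space 2)} {q : Space 2 → Space 2}

/-- Trajectories invariant under translations by two linearly independent vectors meet, so they are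
equal. -/
theorem trajectory_eq_of_independent_translations (hΩ : IsOpen Ω)
    (hv : ∀ z ∈ Ω, ContDiffAt ℝ 1 q z) {x y a b : Space 2} (hx : x ∈ Ω) (hy : y ∈ Ω)
    (ha : a +ᵥ trajectory Ω q x = trajectory Ω q x)
    (hb : b +ᵥ trajectory Ω q y = trajectory Ω q y) (hab : a 0 * b 1 - a 1 * b 0 ≠ 0) :
    trajectory Ω q x = trajectory Ω q y := by
  obtain ⟨g₁, hg₁, hg₁a, hg₁T⟩ := exists_translation_equivariant_curve hΩ hv hx ha
  obtain ⟨g₂, hg₂, hg₂b, hg₂T⟩ := exists_translation_equivariant_curve hΩ hv hy hb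
  have ha0 : toComplex a ≠ 0 := by
    rw [ne_eq, map_eq_zero_iff _ toComplex.injective]
    rintro rfl
    simp at hab
  have him : (toComplex b / toComplex a).im ≠ 0 := by
    rw [Complex.div_im, ← sub_div]
    refine div_ne_zero ?_ (by simpa using ha0)
    simp only [toComplex_re, toComplex_im]
    convert! hab using 1
    ring
  obtain ⟨s, t, hst⟩ := exists_eq_of_independent_translations
    (g₁ := fun t => toComplex (g₁ t) / toComplex a) (g₂ := fun t => toComplex (g₂ t) / toComplex a)
    him ((toComplex.continuous.comp hg₁).div_const _) ((toComplex.continuous.comp hg₂).div_const _)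
    (fun t => by simp [hg₁a, add_div, ha0]) (fun t => by simp [hg₂b, add_div])
  have hgg : g₁ s = g₂ t := toComplex.injective ((div_left_inj' ha0).1 hst)
  rw [← trajectory_eq_of_mem hv (hg₁T s), hgg, trajectory_eq_of_mem hv (hg₂T t)]

/-- A trajectory invariant under a nonzero multiple of a lattice vector `p` is invariant under `p`: it
has a chord equal to `p`, so it meets its translate by `p`. -/
theorem vadd_trajectory_eq_of_zsmul (hΩ : IsOpen Ω) (hΩp : ∀ k ∈ lattice d L, k +ᵥ Ω = Ω)
    (hq : IsAdvection d L Ω q) {y p : Space 2} (hy : y ∈ Ω) (hp : p ∈ lattice d L) (hp0 : p ≠ 0)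
    {n : ℤ} (hn : n ≠ 0) (h : n • p +ᵥ trajectory Ω q y = trajectory Ω q y) :
    p +ᵥ trajectory Ω q y = trajectory Ω q y := by
  have hv : ∀ z ∈ Ω, ContDiffAt ℝ 1 q z := fun z hz => hq.contDiffAt hΩ hz
  -- Replacing `n` by `n * n` makes the multiple positive.
  have h' := zsmul_vadd_set_eq h n
  obtain ⟨g, hg, hgn, hgT⟩ := exists_translation_equivariant_curve hΩ hv hy h'
  have hpc : toComplex p ≠ 0 := by rwa [ne_eq, map_eq_zero_iff _ toComplex.injective]
  have hnn : (0 : ℝ) < n * n := by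
    have : (n : ℝ) ≠ 0 := by exact_mod_cast hn
    exact mul_self_pos.2 this
  obtain ⟨s, t, hst⟩ := exists_eq_add_one_of_translation
    (g := fun t => toComplex (g t) / toComplex p) hnn ((toComplex.continuous.comp hg).div_const _)
    (fun t => by
      beta_reduce
      rw [hgn, map_add, map_zsmul, map_zsmul, add_div]
      simp only [zsmul_eq_mul]
      push_cast
      field_simp)
  have hgs : g s = p + g t := toComplex.injective <| by
    rw [map_add]
    field_simp at hst
    rw [hst, add_comm]
  have hmem : g s ∈ p +ᵥ trajectory Ω q y := hgs ▸ vadd_mem_vadd_set (hgT t)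
  rw [vadd_trajectory hΩp hq hp] at hmem ⊢
  rw [← trajectory_eq_of_mem hv hmem, trajectory_eq_of_mem hv (hgT s)]

theorem exists_int_of_mem_lattice {a : Space 2} (ha : a ∈ lattice d L) (i : Fin 2) :
    ∃ m : ℤ, a i = m * L i := by
  obtain hi | hi := lt_or_ge i.val d
  · exact (ha i).1 hi
  · exact ⟨0, by simp [(ha i).2 hi]⟩

theorem exists_zsmul_eq_zsmul_of_parallel {a b : Space 2} (ha : a ∈ lattice d L)
    (hb : b ∈ lattice d L) (hb0 : b ≠ 0) (hab : a 0 * b 1 - a 1 * b 0 = 0) :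
    ∃ n m : ℤ, n ≠ 0 ∧ n • a = m • b := by
  choose m hm using exists_int_of_mem_lattice ha
  choose n hn using exists_int_of_mem_lattice hb
  obtain ⟨i, hi⟩ : ∃ i, b i ≠ 0 := by
    by_contra! h
    exact hb0 (by ext i; simpa using h i)
  rw [hn] at hi
  have hni := left_ne_zero_of_mul hi
  refine ⟨n i, m i, Int.cast_ne_zero.1 hni, ?_⟩
  have hdet : ∀ j, a i * b j = a j * b i := fun j => by
    fin_cases i <;> fin_cases j <;> simp only [Fin.zero_eta, Fin.mk_one, Fin.isValue] <;> linarith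
  ext j
  have := hdet j
  simp only [PiLp.smul_apply, zsmul_eq_mul, hm, hn] at this ⊢
  refine mul_left_cancel₀ (right_ne_zero_of_mul hi) ?_
  linear_combination -this

end PlaneTrajectories

end PeriodicFlow

theorem lemma1 (d : ℕ) (L : Fin 2 → ℝ)
    (Ω : Set (PeriodicFlow.Space 2)) (hΩ : PeriodicFlow.IsPeriodicDomain d L Ω)
    (q : PeriodicFlow.Space 2 → PeriodicFlow.Space 2) (hq : PeriodicFlow.IsAdvection d L Ω q) :
    (∀ x ∈ Ω, ∀ a : PeriodicFlow.Space 2,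
      PeriodicFlow.IsPeriodicWith d L a (PeriodicFlow.trajectory Ω q x) →
      ∀ y : PeriodicFlow.Space 2, PeriodicFlow.IsUnboundedPeriodic d L Ω q y →
        PeriodicFlow.IsPeriodicWith d L a (PeriodicFlow.trajectory Ω q y)) ∧
    (d = 1 → ∀ x : PeriodicFlow.Space 2, PeriodicFlow.IsUnboundedPeriodic d L Ω q x →
      PeriodicFlow.IsPeriodicWith d L (EuclideanSpace.single 0 (L 0))
        (PeriodicFlow.trajectory Ω q x)) := by
  open PeriodicFlow in
  have hΩo := hΩ.isC3Domain.isOpen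
  refine ⟨?_, ?_⟩
  · rintro x hx a ⟨ha, ha0, hax⟩ y ⟨hy, b, hb, hb0, hby⟩
    by_cases hab : a 0 * b 1 - a 1 * b 0 = 0
    · obtain ⟨n, m, hn, hnm⟩ := exists_zsmul_eq_zsmul_of_parallel ha hb hb0 hab
      refine ⟨ha, ha0, vadd_trajectory_eq_of_zsmul hΩo hΩ.periodic hq hy ha ha0 hn ?_⟩
      rw [hnm]
      exact zsmul_vadd_set_eq hby m
    · rw [← trajectory_eq_of_independent_translations hΩo (fun z hz => hq.contDiffAt hΩo hz)
        hx hy hax hby hab]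
      exact ⟨ha, ha0, hax⟩
  · rintro rfl x ⟨hx, a, ha, ha0, hax⟩
    have hL : L 0 ≠ 0 := (hΩ.period_pos 0 (by simp)).ne'
    have he : EuclideanSpace.single 0 (L 0) ∈ lattice 1 L := fun i => by
      fin_cases i
      · exact ⟨fun _ => ⟨1, by simp⟩, by simp⟩
      · simp
    have he0 : (EuclideanSpace.single 0 (L 0) : Space 2) ≠ 0 := by simpa using hL
    obtain ⟨m, hm⟩ := (ha 0).1 (by simp)
    have ham : a = m • EuclideanSpace.single 0 (L 0) := by
      ext i
      fin_cases i
      · simp [hm]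
      · simpa using (ha 1).2 (by simp)
    refine ⟨he, he0, vadd_trajectory_eq_of_zsmul hΩo hΩ.periodic hq hx he he0 (n := m) ?_ ?_⟩
    · rintro rfl
      exact ha0 (by simpa using ham)
    · rwa [← ham]
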